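/- Let $\mathsf X,\mathsf Y$ be measurable spaces with countably generated $\sigma$-fields (for instance, Polish spaces with their Borel $\sigma$-fields), let $\mu,\tilde\mu$ be probability measures on $\mathsf X$ and $\nu,\tilde\nu$ probability measures on $\mathsf Y$ with $\mu\sim\tilde\mu$, $\nu\sim\tilde\nu$ (mutual absolute continuity) and $$\frac{d\mu}{d\tilde\mu}\in L^2(\tilde\mu),\quad \Big(\frac{d\mu}{d\tilde\mu}\Big)^{-1}\in L^\infty(\tilde\mu),\quad \frac{d\nu}{d\tilde\nu}\in L^2(\tilde\nu),\quad \Big(\frac{d\nu}{d\tilde\nu}\Big)^{-1}\in L^\infty(\tilde\nu),$$ and put $P:=\tilde\mu\otimes\tilde\nu$. Let $\Pi(\mu,\nu)$ be the set of couplings of $\mu$ and $\nu$. For a cost $c:\mathsf X\times\mathsf Y\to\mathbb R$ consider the quadratically regularized optimal transport problem $$\inf_{\pi\in\Pi(\mu,\nu)}\int c\,d\pi+\frac12\Big\|\frac{d\pi}{dP}\Big\|_{L^2(P)}^2,$$ where couplings $\pi\not\ll P$ have infinite cost. Measurable functions $f:\mathsf X\to\mathbb R$, $g:\mathsf Y\to\mathbb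 R$ are called potentials if $(f\oplus g-c)_+$ is the $P$-density of an optimal coupling, $(f,g)\in L^1(\mu)\times L^1(\nu)$ maximizes $\int f\,d\mu+\int g\,d\nu-\frac12\int(f\oplus g-c)_+^2\,dP$ over $L^1(\mu)\times L^1(\nu)$, and $$\int(f(x)+g(y)-c(x,y))_+\,\tilde\mu(dx)=\frac{d\nu}{d\tilde\nu}(y)\ \ \tilde\nu\text{-a.e.},\qquad \int(f(x)+g(y)-c(x,y))_+\,\tilde\nu(dy)=\frac{d\mu}{d\tilde\mu}(x)\ \ \tilde\mu\text{-a.e.}$$ (where $(f\oplus g)(x,y):=f(x)+g(y)$). Let $c\equiv0$. Then the problem has a unique optimal coupling $\pi_*$, and $$\pi_*\sim P\quad\Longleftrightarrow\quad \frac{d\mu}{d\tilde\mu}(x)+\frac{d\nu}{d\tilde\nu}(y)>1\quad\text{for }P\text{-a.e. }(x,y).$$ In that case, $\frac{d\pi_*}{dP}(x,y)=\frac{d\mu}{d\tilde\mu}(x)+\frac{d\nu}{d\tilde\nu}(y)-1$ for $P$-a.e. $(x,y)$, and $(f,g)=\big(\frac{d\mu}{d\tilde\mu}-\frac12,\ \frac{d\nu}{d\tilde\nu}-\frac12\big)$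 are potentials. In particular, if $\nu=\tilde\nu$, the optimal coupling is $\pi_*=\mu\otimes\nu$. -/

import Mathlib

open MeasureTheory
open scoped ENNReal

noncomputable section

namespace QOT

/-- Mutual absolute continuity of two measures. -/
def Equivalent {Ω : Type*} [MeasurableSpace Ω] (ρ σ : Measure Ω) : Prop :=
  ρ ≪ σ ∧ σ ≪ ρ

/-- The Radon-Nikodym density `dρ/dσ` as a (measurable) real-valued function. -/
def density {Ω : Type*} [MeasurableSpace Ω] (ρ σ : Measure Ω) (x : Ω) : ℝ :=
  (ρ.rnDeriv σ x).toReal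

/-- A marginal `ρ` is admissible for the reference measure `σ`: the two are equivalent,
`dρ/dσ ∈ L²(σ)` and `(dρ/dσ)⁻¹ ∈ L^∞(σ)`. -/
structure AdmissibleReference {Ω : Type*} [MeasurableSpace Ω] (ρ σ : Measure Ω) : Prop where
  equivalent : Equivalent ρ σ
  memLp_density : MemLp (density ρ σ) 2 σ
  memLp_inv_density : MemLp (fun x => (density ρ σ x)⁻¹) ∞ σ

variable {X Y : Type*} [MeasurableSpace X] [MeasurableSpace Y]

/-- `Π(μ, ν)`: the measures on `X × Y` with marginals `μ` and `ν`. -/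
def couplings (μ : Measure X) (ν : Measure Y) : Set (Measure (X × Y)) :=
  {π | π.map Prod.fst = μ ∧ π.map Prod.snd = ν}

/-- The extended integral `∫ c dπ` of a function whose negative part is `π`-integrable,
with values in `(-∞, ∞]`. -/
def extIntegral {Ω : Type*} [MeasurableSpace Ω] (c : Ω → ℝ) (π : Measure Ω) : EReal :=
  ((∫⁻ z, ENNReal.ofReal (c z) ∂π : ℝ≥0∞) : EReal) -
    ((∫⁻ z, ENNReal.ofReal (-c z) ∂π : ℝ≥0∞) : EReal)

open Classical in
/-- The objective of quadratically regularized optimal transport,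
`∫ c dπ + ½ ‖dπ/dP‖²_{L²(P)}`, which is `+∞` if `π` is not absolutely continuous
with respect to `P`. -/
def objective {Ω : Type*} [MeasurableSpace Ω] (c : Ω → ℝ) (P π : Measure Ω) : EReal :=
  if π ≪ P then
    extIntegral c π + (((1 / 2 : ℝ≥0∞) * ∫⁻ z, (π.rnDeriv P z) ^ 2 ∂P : ℝ≥0∞) : EReal)
  else ⊤

/-- `π` minimizes the objective over `Π(μ, ν)`. -/
def IsOptimalCoupling (c : X × Y → ℝ) (P : Measure (X × Y)) (μ : Measure X) (ν : Measure Y)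
    (π : Measure (X × Y)) : Prop :=
  π ∈ couplings μ ν ∧ ∀ π' ∈ couplings μ ν, objective c P π ≤ objective c P π'

/-- The dual objective `∫ f dμ + ∫ g dν - ½ ∫ (f ⊕ g - c)₊² dP`, with values in `[-∞, ∞)`
for `f ∈ L¹(μ)` and `g ∈ L¹(ν)`. -/
def dualObjective (c : X × Y → ℝ) (P : Measure (X × Y)) (μ : Measure X) (ν : Measure Y)
    (f : X → ℝ) (g : Y → ℝ) : EReal :=
  ((∫ x, f x ∂μ + ∫ y, g y ∂ν : ℝ) : EReal) -
    (((1 / 2 : ℝ≥0∞) *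
      ∫⁻ z, ENNReal.ofReal ((max (f z.1 + g z.2 - c z) 0) ^ 2) ∂P : ℝ≥0∞) : EReal)

/-- `(f, g) ∈ L¹(μ) × L¹(ν)` maximizes the dual objective over `L¹(μ) × L¹(ν)`. -/
def IsDualSolution (c : X × Y → ℝ) (P : Measure (X × Y)) (μ : Measure X) (ν : Measure Y)
    (f : X → ℝ) (g : Y → ℝ) : Prop :=
  Integrable f μ ∧ Integrable g ν ∧
    ∀ (f' : X → ℝ) (g' : Y → ℝ), Integrable f' μ → Integrable g' ν →
      dualObjective c P μ ν f' g' ≤ dualObjective c P μ ν f g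

/-- `(f, g)` are potentials for the cost `c`, marginals `μ, ν` and reference `P = μ' ⊗ ν'`:
measurable functions such that `(f ⊕ g - c)₊` is the `P`-density of the optimal coupling, that
solve the dual problem, and that satisfy the marginal equations. These properties are equivalent
to one another in the standard setting; all of them are listed here. -/
structure IsPotentials (c : X × Y → ℝ) (μ μ' : Measure X) (ν ν' : Measure Y)
    (f : X → ℝ) (g : Y → ℝ) : Prop where
  measurable_left : Measurable f
  measurable_right : Measurable g
  optimal : IsOptimalCoupling c (μ'.prod ν') μ ν
    ((μ'.prod ν').withDensity fun z => ENNReal.ofReal (max (f z.1 + g z.2 - c z) 0))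
  dual : IsDualSolution c (μ'.prod ν') μ ν f g
  marginal_right : ∀ᵐ y ∂ν', ∫ x, max (f x + g y - c (x, y)) 0 ∂μ' = density ν ν' y
  marginal_left : ∀ᵐ x ∂μ', ∫ y, max (f x + g y - c (x, y)) 0 ∂ν' = density μ μ' x

end QOT

end

/-!
For the cost `0` the regularized transport problem asks for the element of least norm in the set of
square-integrable densities of couplings, a closed convex subset of `L²(P)`. It is nonempty, because
it contains the density of `μ ⊗ ν`, so the minimizer exists and is unique
(`QOT.exists_isMinimalDensity`, `QOT.IsMinimalDensity.ae_eq`).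

Write `a = dμ/dμ'` and `b = dν/dν'`. The function `a ⊕ b - 1` has the marginals `a` and `b`, and,
being a sum of functions of one variable, it has the same inner product with all coupling densities.
If it is nonnegative it is therefore the minimizer (`QOT.isMinimalDensity_add_sub_one`). Weak
duality and the absence of a gap then show that `(a - 1/2, b - 1/2)` are potentials
(`QOT.isPotentials_density_sub_half`).

Conversely, let the minimizer `h` be positive almost everywhere. For a pair of points `(x, y)`,
`(x', y')` mass may be moved between these two points and the other two corners `(x, y')`,
`(x', y)` without changing the marginals. Averaging such moves with a weight which has the sign of
`D = h(x,y) + h(x',y') - h(x,y') - h(x',y)` and is bounded by the minimum of `h` at the four corners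
gives a perturbation `φ` with zero marginals and `|φ| ≤ h`. First-order optimality
(`QOT.IsMinimalDensity.integral_mul_eq_zero`) makes the weighted integral of `D` vanish, hence
`D = 0` almost everywhere (`QOT.IsMinimalDensity.mixedDiff_eq_zero`). Integrating `D = 0` over
`(x', y')` gives `h = a ⊕ b - 1` (`QOT.IsMinimalDensity.ae_eq_add_sub_one`), and `a ⊕ b > 1`
follows from `h > 0`. This argument does not pass through the existence of potentials.

If `ν = ν'`, then `b = 1`, so `a ⊕ b - 1 = a ≥ 0` is the minimizer, which is the density of `μ ⊗ ν`.
-/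

namespace QOT

/-! ### Square-integrable coupling densities -/

section

variable {X Y : Type*} [MeasurableSpace X] [MeasurableSpace Y]

/-- `h` is (a representative of) the `P`-density of a coupling of `μ` and `ν`, and lies in `L²(P)`.
The marginal conditions are written as integrals over cylinder sets. -/
structure IsCouplingDensity (P : Measure (X × Y)) (μ : Measure X) (ν : Measure Y)
    (h : X × Y → ℝ) : Prop where
  memLp : MemLp h 2 P
  nonneg : 0 ≤ᵐ[P] h
  fst : ∀ A, MeasurableSet A → ∫ z in Prod.fst ⁻¹' A, h z ∂P = μ.real A
  snd : ∀ B, MeasurableSet B → ∫ z in Prod.snd ⁻¹' B, h z ∂P = ν.real B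

/-- `h` has the least `L²(P)`-norm among all coupling densities. -/
def IsMinimalDensity (P : Measure (X × Y)) (μ : Measure X) (ν : Measure Y)
    (h : X × Y → ℝ) : Prop :=
  IsCouplingDensity P μ ν h ∧
    ∀ k, IsCouplingDensity P μ ν k → ∫ z, h z ^ 2 ∂P ≤ ∫ z, k z ^ 2 ∂P

lemma IsCouplingDensity.congr {P : Measure (X × Y)} {μ : Measure X} {ν : Measure Y}
    {h k : X × Y → ℝ} (hh : IsCouplingDensity P μ ν h) (hk : h =ᵐ[P] k) :
    IsCouplingDensity P μ ν k where
  memLp := hh.memLp.ae_eq hk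
  nonneg := by
    filter_upwards [hh.nonneg, hk] with z h1 h2
    rwa [← h2]
  fst A hA := by
    rw [← hh.fst A hA]
    exact integral_congr_ae (ae_restrict_of_ae hk.symm)
  snd B hB := by
    rw [← hh.snd B hB]
    exact integral_congr_ae (ae_restrict_of_ae hk.symm)

variable {P : Measure (X × Y)} [IsProbabilityMeasure P] {μ : Measure X} {ν : Measure Y}
  {h k : X × Y → ℝ}

lemma IsCouplingDensity.integrable (hh : IsCouplingDensity P μ ν h) : Integrable h P :=
  hh.memLp.integrable (by norm_num)

/-- Adding a function with vanishing marginals keeps the marginals of a coupling density. -/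
lemma IsCouplingDensity.add {φ : X × Y → ℝ} (hh : IsCouplingDensity P μ ν h)
    (hφ : MemLp φ 2 P)
    (hφ₁ : ∀ A, MeasurableSet A → ∫ z in Prod.fst ⁻¹' A, φ z ∂P = 0)
    (hφ₂ : ∀ B, MeasurableSet B → ∫ z in Prod.snd ⁻¹' B, φ z ∂P = 0)
    (hpos : 0 ≤ᵐ[P] h + φ) : IsCouplingDensity P μ ν (h + φ) where
  memLp := hh.memLp.add hφ
  nonneg := hpos
  fst A hA := by
    have hi : Integrable φ P := hφ.integrable (by norm_num)
    simp only [Pi.add_apply]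
    rw [integral_add hh.integrable.integrableOn hi.integrableOn, hh.fst A hA, hφ₁ A hA, add_zero]
  snd B hB := by
    have hi : Integrable φ P := hφ.integrable (by norm_num)
    simp only [Pi.add_apply]
    rw [integral_add hh.integrable.integrableOn hi.integrableOn, hh.snd B hB, hφ₂ B hB, add_zero]

lemma IsCouplingDensity.convexComb (hh : IsCouplingDensity P μ ν h)
    (hk : IsCouplingDensity P μ ν k) {s t : ℝ} (hs : 0 ≤ s) (ht : 0 ≤ t) (hst : s + t = 1) :
    IsCouplingDensity P μ ν (s • h + t • k) where
  memLp := (hh.memLp.const_smul s).add (hk.memLp.const_smul t)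
  nonneg := by
    filter_upwards [hh.nonneg, hk.nonneg] with z h1 h2
    simp only [Pi.zero_apply, Pi.add_apply, Pi.smul_apply, smul_eq_mul] at *
    positivity
  fst A hA := by
    simp only [Pi.add_apply, Pi.smul_apply, smul_eq_mul]
    rw [integral_add (hh.integrable.integrableOn.const_mul s)
        (hk.integrable.integrableOn.const_mul t),
      integral_const_mul, integral_const_mul, hh.fst A hA, hk.fst A hA, ← add_mul, hst, one_mul]
  snd B hB := by
    simp only [Pi.add_apply, Pi.smul_apply, smul_eq_mul]
    rw [integral_add (hh.integrable.integrableOn.const_mul s)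
        (hk.integrable.integrableOn.const_mul t),
      integral_const_mul, integral_const_mul, hh.snd B hB, hk.snd B hB, ← add_mul, hst, one_mul]

lemma IsCouplingDensity.withDensity_mem_couplings [IsFiniteMeasure μ] [IsFiniteMeasure ν]
    (hh : IsCouplingDensity P μ ν h) :
    P.withDensity (fun z => ENNReal.ofReal (h z)) ∈ couplings μ ν := by
  constructor
  · ext A hA
    rw [Measure.map_apply measurable_fst hA, withDensity_apply _ (measurable_fst hA),
      ← ofReal_integral_eq_lintegral_ofReal hh.integrable.integrableOn
        (ae_restrict_of_ae hh.nonneg), hh.fst A hA, ofReal_measureReal]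
  · ext B hB
    rw [Measure.map_apply measurable_snd hB, withDensity_apply _ (measurable_snd hB),
      ← ofReal_integral_eq_lintegral_ofReal hh.integrable.integrableOn
        (ae_restrict_of_ae hh.nonneg), hh.snd B hB, ofReal_measureReal]

lemma measurable_density {Ω : Type*} [MeasurableSpace Ω] (ρ σ : Measure Ω) :
    Measurable (density ρ σ) :=
  (Measure.measurable_rnDeriv ρ σ).ennreal_toReal

lemma density_nonneg {Ω : Type*} [MeasurableSpace Ω] (ρ σ : Measure Ω) (x : Ω) :
    0 ≤ density ρ σ x :=
  ENNReal.toReal_nonneg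

lemma withDensity_ofReal_density {Ω : Type*} [MeasurableSpace Ω] {ρ σ : Measure Ω}
    [IsFiniteMeasure ρ] [SigmaFinite σ] (hρ : ρ ≪ σ) :
    σ.withDensity (fun x => ENNReal.ofReal (density ρ σ x)) = ρ := by
  conv_rhs => rw [← Measure.withDensity_rnDeriv_eq ρ σ hρ]
  refine withDensity_congr_ae ?_
  filter_upwards [Measure.rnDeriv_lt_top ρ σ] with x hx
  exact ENNReal.ofReal_toReal hx.ne

lemma isProbabilityMeasure_of_mem_couplings [IsProbabilityMeasure μ] {π : Measure (X × Y)}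
    (hπ : π ∈ couplings μ ν) : IsProbabilityMeasure π := by
  constructor
  rw [← Set.preimage_univ (f := Prod.fst), ← Measure.map_apply measurable_fst MeasurableSet.univ,
    hπ.1, measure_univ]

/-- A coupling of finite cost has a square-integrable density. -/
lemma isCouplingDensity_density [IsProbabilityMeasure μ] {π : Measure (X × Y)}
    (hπ : π ∈ couplings μ ν) (hfin : objective (fun _ => 0) P π ≠ ⊤) :
    π ≪ P ∧ IsCouplingDensity P μ ν (density π P) := by
  have := isProbabilityMeasure_of_mem_couplings hπ
  have hac : π ≪ P := by
    by_contra hac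
    simp [objective, hac] at hfin
  refine ⟨hac, ?_, ae_of_all _ (density_nonneg π P), fun A hA => ?_, fun B hB => ?_⟩
  · have hL : ∫⁻ z, π.rnDeriv P z ^ 2 ∂P ≠ ∞ := by
      intro hL
      simp [objective, hac, extIntegral, hL, ENNReal.mul_top] at hfin
    rw [memLp_two_iff_integrable_sq (measurable_density π P).aestronglyMeasurable]
    refine ⟨((measurable_density π P).pow_const 2).aestronglyMeasurable, ?_⟩
    rw [hasFiniteIntegral_iff_ofReal (ae_of_all _ fun z => sq_nonneg _)]
    refine lt_of_le_of_lt (lintegral_mono fun z => ?_) hL.lt_top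
    rw [density, ENNReal.ofReal_pow ENNReal.toReal_nonneg]
    gcongr
    exact ENNReal.ofReal_toReal_le
  · simp only [density]
    rw [Measure.setIntegral_toReal_rnDeriv hac, ← hπ.1, map_measureReal_apply measurable_fst hA]
  · simp only [density]
    rw [Measure.setIntegral_toReal_rnDeriv hac, ← hπ.2, map_measureReal_apply measurable_snd hB]

lemma coe_half_mul_ofReal {r : ℝ} (hr : 0 ≤ r) :
    (((1 / 2 : ℝ≥0∞) * ENNReal.ofReal r : ℝ≥0∞) : EReal) = ((1 / 2 * r : ℝ) : EReal) := by
  have h2 : (1 / 2 : ℝ≥0∞) = ENNReal.ofReal (1 / 2) := by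
    rw [ENNReal.ofReal_div_of_pos (by norm_num)]
    simp
  rw [h2, ← ENNReal.ofReal_mul (by norm_num), EReal.coe_ennreal_ofReal, max_eq_left (by positivity)]

lemma objective_withDensity (hh : MemLp h 2 P) (hpos : 0 ≤ᵐ[P] h) :
    objective (fun _ => 0) P (P.withDensity fun z => ENNReal.ofReal (h z)) =
      ((1 / 2 * ∫ z, h z ^ 2 ∂P : ℝ) : EReal) := by
  have hL : ∫⁻ z, (P.withDensity fun z => ENNReal.ofReal (h z)).rnDeriv P z ^ 2 ∂P =
      ENNReal.ofReal (∫ z, h z ^ 2 ∂P) := by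
    rw [ofReal_integral_eq_lintegral_ofReal hh.integrable_sq (ae_of_all _ fun z => sq_nonneg _)]
    refine lintegral_congr_ae ?_
    filter_upwards [Measure.rnDeriv_withDensity₀ P hh.1.aemeasurable.ennreal_ofReal, hpos]
      with z hz h0
    rw [hz, ENNReal.ofReal_pow h0]
  rw [objective, if_pos (withDensity_absolutelyContinuous _ _), hL,
    coe_half_mul_ofReal (integral_nonneg fun z => sq_nonneg _)]
  simp [extIntegral]

/-- As soon as some coupling has finite cost, an optimal coupling has a density of minimal norm. -/
lemma IsOptimalCoupling.isMinimalDensity [IsProbabilityMeasure μ] [IsFiniteMeasure ν]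
    {π : Measure (X × Y)} (hπ : IsOptimalCoupling (fun _ => 0) P μ ν π)
    (hk : IsCouplingDensity P μ ν k) :
    π ≪ P ∧ IsMinimalDensity P μ ν (density π P) := by
  have hfin : objective (fun _ => 0) P π ≠ ⊤ := by
    refine ne_top_of_le_ne_top ?_ (hπ.2 _ hk.withDensity_mem_couplings)
    rw [objective_withDensity hk.memLp hk.nonneg]
    exact EReal.coe_ne_top _
  obtain ⟨hac, hd⟩ := isCouplingDensity_density hπ.1 hfin
  have := isProbabilityMeasure_of_mem_couplings hπ.1
  refine ⟨hac, hd, fun l hl => ?_⟩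
  have hle := hπ.2 _ hl.withDensity_mem_couplings
  have hobj := objective_withDensity hd.memLp hd.nonneg
  rw [withDensity_ofReal_density hac] at hobj
  rw [hobj, objective_withDensity hl.memLp hl.nonneg, EReal.coe_le_coe_iff] at hle
  linarith

lemma IsMinimalDensity.isOptimalCoupling [IsProbabilityMeasure μ] [IsFiniteMeasure ν]
    (hh : IsMinimalDensity P μ ν h) :
    IsOptimalCoupling (fun _ => 0) P μ ν (P.withDensity fun z => ENNReal.ofReal (h z)) := by
  refine ⟨hh.1.withDensity_mem_couplings, fun π hπ => ?_⟩
  by_cases hfin : objective (fun _ => 0) P π = ⊤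
  · rw [hfin]
    exact le_top
  obtain ⟨hac, hd⟩ := isCouplingDensity_density hπ hfin
  have := isProbabilityMeasure_of_mem_couplings hπ
  have hle := hh.2 _ hd
  have hobj := objective_withDensity hd.memLp hd.nonneg
  rw [withDensity_ofReal_density hac] at hobj
  rw [hobj, objective_withDensity hh.1.memLp hh.1.nonneg, EReal.coe_le_coe_iff]
  linarith

/-! ### Existence and uniqueness of the minimal density -/

/-- Two minimal densities agree: by the parallelogram identity their midpoint would otherwise
have a smaller norm. -/
lemma IsMinimalDensity.ae_eq (hh : IsMinimalDensity P μ ν h) (hk : IsMinimalDensity P μ ν k) :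
    h =ᵐ[P] k := by
  have hm := hh.2 _ (hh.1.convexComb hk.1 (s := 1 / 2) (t := 1 / 2)
    (by norm_num) (by norm_num) (by norm_num))
  have hkh := hk.2 _ hh.1
  have hsub : MemLp (fun z => h z - k z) 2 P := hh.1.memLp.sub hk.1.memLp
  have hpar : ∫ z, ((1 / 2 : ℝ) • h + (1 / 2 : ℝ) • k) z ^ 2 ∂P =
      1 / 2 * ∫ z, h z ^ 2 ∂P + 1 / 2 * ∫ z, k z ^ 2 ∂P - 1 / 4 * ∫ z, (h z - k z) ^ 2 ∂P := by
    have hi : Integrable (fun z => 1 / 2 * h z ^ 2 + 1 / 2 * k z ^ 2) P :=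
      (hh.1.memLp.integrable_sq.const_mul _).add (hk.1.memLp.integrable_sq.const_mul _)
    rw [← integral_const_mul, ← integral_const_mul, ← integral_const_mul, ← integral_add
      (hh.1.memLp.integrable_sq.const_mul _) (hk.1.memLp.integrable_sq.const_mul _),
      ← integral_sub hi (hsub.integrable_sq.const_mul _)]
    refine integral_congr_ae (ae_of_all _ fun z => ?_)
    simp only [Pi.add_apply, Pi.smul_apply, smul_eq_mul]
    ring
  have h0 : ∫ z, (h z - k z) ^ 2 ∂P = 0 :=
    le_antisymm (by linarith) (integral_nonneg fun z => sq_nonneg _)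
  rw [integral_eq_zero_iff_of_nonneg (fun z => sq_nonneg _) hsub.integrable_sq] at h0
  filter_upwards [h0] with z hz
  have := pow_eq_zero_iff (two_ne_zero) |>.1 hz
  linarith

/-- The coupling densities form a closed convex subset of `L²(P)`, so the origin has a projection
onto it. -/
lemma exists_isMinimalDensity (hk : IsCouplingDensity P μ ν k) :
    ∃ h, IsMinimalDensity P μ ν h := by
  let K : Set (Lp ℝ 2 P) := {u | IsCouplingDensity P μ ν u}
  have hcont : ∀ s, MeasurableSet s → Continuous fun u : Lp ℝ 2 P => ∫ z in s, u z ∂P := by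
    intro s hs
    have : (fun u : Lp ℝ 2 P => ∫ z in s, u z ∂P) =
        fun u => inner ℝ (indicatorConstLp 2 hs (measure_ne_top P s) (1 : ℝ)) u := by
      ext u
      rw [L2.inner_indicatorConstLp_one]
    rw [this]
    fun_prop
  have hclosed : IsClosed K := by
    have hK : K = {u | 0 ≤ u} ∩
        ((⋂ A, ⋂ _ : MeasurableSet A, {u | ∫ z in Prod.fst ⁻¹' A, u z ∂P = μ.real A}) ∩
        ⋂ B, ⋂ _ : MeasurableSet B, {u | ∫ z in Prod.snd ⁻¹' B, u z ∂P = ν.real B}) := by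
      ext u
      simp only [K, Set.mem_inter_iff, Set.mem_ofPred_eq, Set.mem_iInter]
      exact ⟨fun hu => ⟨(Lp.coeFn_nonneg u).1 hu.nonneg, hu.fst, hu.snd⟩,
        fun hu => ⟨Lp.memLp u, (Lp.coeFn_nonneg u).2 hu.1, hu.2.1, hu.2.2⟩⟩
    rw [hK]
    refine isClosed_Ici.inter (IsClosed.inter ?_ ?_)
    · exact isClosed_iInter fun A => isClosed_iInter fun hA =>
        isClosed_eq (hcont _ (measurable_fst hA)) continuous_const
    · exact isClosed_iInter fun B => isClosed_iInter fun hB =>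
        isClosed_eq (hcont _ (measurable_snd hB)) continuous_const
  have hconv : Convex ℝ K := by
    intro u hu v hv s t hs ht hst
    refine (IsCouplingDensity.convexComb hu hv hs ht hst).congr ?_
    filter_upwards [Lp.coeFn_add (s • u) (t • v), Lp.coeFn_smul s u, Lp.coeFn_smul t v]
      with z h1 h2 h3
    rw [h1, Pi.add_apply, Pi.add_apply, h2, h3]
  have hne : K.Nonempty := ⟨hk.memLp.toLp k, hk.congr hk.memLp.coeFn_toLp.symm⟩
  have hnorm : ∀ u : Lp ℝ 2 P, ‖u‖ ^ 2 = ∫ z, u z ^ 2 ∂P := by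
    intro u
    rw [← real_inner_self_eq_norm_sq, L2.inner_def]
    simp [pow_two]
  obtain ⟨v, hv, hmin⟩ :=
    exists_norm_eq_iInf_of_complete_convex hne hclosed.isComplete hconv 0
  refine ⟨v, hv, fun l hl => ?_⟩
  have hl' : hl.memLp.toLp l ∈ K := hl.congr hl.memLp.coeFn_toLp.symm
  have hle : ‖v‖ ≤ ‖hl.memLp.toLp l‖ := by
    have := ciInf_le (f := fun w : K => ‖(0 : Lp ℝ 2 P) - w‖)
      ⟨0, by rintro _ ⟨w, rfl⟩; positivity⟩ ⟨_, hl'⟩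
    rw [← hmin] at this
    simpa using this
  have hsq := pow_le_pow_left₀ (norm_nonneg _) hle 2
  rw [hnorm, hnorm] at hsq
  refine hsq.trans_eq (integral_congr_ae ?_)
  filter_upwards [hl.memLp.coeFn_toLp] with z hz
  rw [hz]

/-- First-order optimality: a minimal density is orthogonal to every admissible two-sided
perturbation. -/
lemma IsMinimalDensity.integral_mul_eq_zero {φ : X × Y → ℝ} (hh : IsMinimalDensity P μ ν h)
    (hφ : MemLp φ 2 P) (hle : ∀ᵐ z ∂P, |φ z| ≤ h z)
    (hφ₁ : ∀ A, MeasurableSet A → ∫ z in Prod.fst ⁻¹' A, φ z ∂P = 0)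
    (hφ₂ : ∀ B, MeasurableSet B → ∫ z in Prod.snd ⁻¹' B, φ z ∂P = 0) :
    ∫ z, h z * φ z ∂P = 0 := by
  have hint : Integrable (fun z => h z * φ z) P := hh.1.memLp.integrable_mul hφ
  have key : ∀ t : ℝ, |t| ≤ 1 →
      0 ≤ t * (2 * ∫ z, h z * φ z ∂P) + t ^ 2 * ∫ z, φ z ^ 2 ∂P := by
    intro t ht
    have hd : IsCouplingDensity P μ ν (h + t • φ) := by
      refine hh.1.add (hφ.const_smul t) (fun A hA => ?_) (fun B hB => ?_) ?_
      · simp only [Pi.smul_apply, smul_eq_mul, integral_const_mul, hφ₁ A hA, mul_zero]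
      · simp only [Pi.smul_apply, smul_eq_mul, integral_const_mul, hφ₂ B hB, mul_zero]
      · filter_upwards [hle] with z hz
        have : |t * φ z| ≤ h z := by
          rw [abs_mul]
          exact (mul_le_of_le_one_left (abs_nonneg _) ht).trans hz
        simp only [Pi.zero_apply, Pi.add_apply, Pi.smul_apply, smul_eq_mul]
        linarith [neg_abs_le (t * φ z)]
    have hexp : ∫ z, (h + t • φ) z ^ 2 ∂P = ∫ z, h z ^ 2 ∂P +
        (2 * t * ∫ z, h z * φ z ∂P + t ^ 2 * ∫ z, φ z ^ 2 ∂P) := by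
      have hi : Integrable (fun z => 2 * t * (h z * φ z) + t ^ 2 * φ z ^ 2) P :=
        (hint.const_mul _).add (hφ.integrable_sq.const_mul _)
      rw [← integral_const_mul, ← integral_const_mul,
        ← integral_add (hint.const_mul _) (hφ.integrable_sq.const_mul _),
        ← integral_add hh.1.memLp.integrable_sq hi]
      refine integral_congr_ae (ae_of_all _ fun z => ?_)
      simp only [Pi.add_apply, Pi.smul_apply, smul_eq_mul]
      ring
    have := hh.2 _ hd
    rw [hexp] at this
    linarith
  set I := ∫ z, h z * φ z ∂P
  set Q := ∫ z, φ z ^ 2 ∂P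
  have hQ : 0 ≤ Q := integral_nonneg fun z => sq_nonneg _
  -- The quadratic `2 t I + t² Q` is nonnegative near `0`; test it at `t = -I / (1 + |I| + Q)`.
  set d := 1 + |I| + Q
  have hdpos : 0 < d := by positivity
  have hd1 : |-I / d| ≤ 1 := by
    rw [abs_div, abs_neg, abs_of_pos hdpos, div_le_one hdpos]
    simp only [d]
    linarith
  have hk := key _ hd1
  have heq : -I / d * (2 * I) + (-I / d) ^ 2 * Q = -(I ^ 2 * (2 * d - Q)) / d ^ 2 := by
    field_simp
    ring
  rw [heq] at hk
  have h2 : 0 ≤ -(I ^ 2 * (2 * d - Q)) := by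
    by_contra hneg
    push Not at hneg
    exact absurd hk (not_le.2 (div_neg_of_neg_of_pos hneg (by positivity)))
  have hpos : 0 < 2 * d - Q := by
    simp only [d]
    linarith [abs_nonneg I]
  have : I ^ 2 ≤ 0 := by
    by_contra hI
    push Not at hI
    nlinarith [mul_pos hI hpos]
  exact pow_eq_zero_iff two_ne_zero |>.1 (le_antisymm this (sq_nonneg I))

end

/-! ### Four-point perturbations -/

section

variable {X Y : Type*} {h : X × Y → ℝ}

/-- Exchanges the second coordinates of two points of `X × Y`. -/
def exchange (p : (X × Y) × (X × Y)) : (X × Y) × (X × Y) :=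
  ((p.1.1, p.2.2), (p.2.1, p.1.2))

/-- The mixed difference `h(x,y) + h(x',y') - h(x,y') - h(x',y)`, which vanishes exactly when `h`
is additively separated on the four points. -/
def mixedDiff (h : X × Y → ℝ) (p : (X × Y) × (X × Y)) : ℝ :=
  h p.1 + h p.2 - h (exchange p).1 - h (exchange p).2

/-- The least of `1` and the values of `h` at the four points `(x,y)`, `(x',y')`, `(x,y')`,
`(x',y)`. -/
def cornerMin (h : X × Y → ℝ) (p : (X × Y) × (X × Y)) : ℝ :=
  min (min (min (h p.1) (h p.2)) (min (h (exchange p).1) (h (exchange p).2))) 1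

/-- The four-point weight used to perturb `h`: it has the sign of the mixed difference, and is
small enough for the perturbed function to stay nonnegative. -/
noncomputable def weight (h : X × Y → ℝ) (p : (X × Y) × (X × Y)) : ℝ :=
  mixedDiff h p / (1 + |mixedDiff h p|) * cornerMin h p

lemma weight_exchange (p : (X × Y) × (X × Y)) : weight h (exchange p) = -weight h p := by
  have hd : mixedDiff h (exchange p) = -mixedDiff h p := by
    simp only [mixedDiff, exchange]
    ring
  have hc : cornerMin h (exchange p) = cornerMin h p := by
    simp only [cornerMin, exchange]
    rw [min_comm (min (h (p.1.1, p.2.2)) _)]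
  rw [weight, weight, hd, hc, abs_neg]
  ring

lemma weight_swap (p : (X × Y) × (X × Y)) : weight h p.swap = weight h p := by
  have hd : mixedDiff h p.swap = mixedDiff h p := by
    simp only [mixedDiff, exchange, Prod.fst_swap, Prod.snd_swap]
    ring
  have hc : cornerMin h p.swap = cornerMin h p := by
    simp only [cornerMin, exchange, Prod.fst_swap, Prod.snd_swap]
    rw [min_comm (h p.2), min_comm (h (p.2.1, p.1.2))]
  rw [weight, weight, hd, hc]

lemma cornerMin_nonneg (hpos : ∀ z, 0 ≤ h z) (p : (X × Y) × (X × Y)) : 0 ≤ cornerMin h p := by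
  simp [cornerMin, hpos]

lemma abs_weight_le (hpos : ∀ z, 0 ≤ h z) (p : (X × Y) × (X × Y)) :
    |weight h p| ≤ cornerMin h p := by
  have hc := cornerMin_nonneg hpos p
  have h1 : |mixedDiff h p / (1 + |mixedDiff h p|)| ≤ 1 := by
    have h2 : 0 < 1 + |mixedDiff h p| := by positivity
    rw [abs_div, abs_of_pos h2, div_le_one h2]
    linarith
  rw [weight, abs_mul, abs_of_nonneg hc]
  exact mul_le_of_le_one_left hc h1

lemma abs_weight_le_one (hpos : ∀ z, 0 ≤ h z) (p : (X × Y) × (X × Y)) : |weight h p| ≤ 1 :=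
  (abs_weight_le hpos p).trans (min_le_right _ _)

lemma abs_weight_le_left (hpos : ∀ z, 0 ≤ h z) (p : (X × Y) × (X × Y)) : |weight h p| ≤ h p.1 :=
  (abs_weight_le hpos p).trans
    ((min_le_left _ _).trans ((min_le_left _ _).trans (min_le_left _ _)))

end

section

variable {X Y : Type*} [MeasurableSpace X] [MeasurableSpace Y]
  {μ' : Measure X} {ν' : Measure Y} [IsProbabilityMeasure μ'] [IsProbabilityMeasure ν']

lemma measurePreserving_exchange :
    MeasurePreserving (exchange (X := X) (Y := Y))
      ((μ'.prod ν').prod (μ'.prod ν')) ((μ'.prod ν').prod (μ'.prod ν')) := by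
  -- On `Y × (X × Y)` the two copies of `Y` are exchanged by passing through `X × (Y × Y)`.
  have hinner : MeasurePreserving (fun q : Y × (X × Y) => (q.2.2, (q.2.1, q.1)))
      (ν'.prod (μ'.prod ν')) (ν'.prod (μ'.prod ν')) :=
    (Measure.measurePreserving_swap (μ := μ'.prod ν') (ν := ν')).comp
      ((measurePreserving_prodAssoc μ' ν' ν').symm.comp
        (((MeasurePreserving.id μ').prod (Measure.measurePreserving_swap (μ := ν') (ν := ν'))).comp
          ((measurePreserving_prodAssoc μ' ν' ν').comp
            (Measure.measurePreserving_swap (μ := ν') (ν := μ'.prod ν')))))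
  exact (measurePreserving_prodAssoc μ' ν' (μ'.prod ν')).symm.comp
    (((MeasurePreserving.id μ').prod hinner).comp
      (measurePreserving_prodAssoc μ' ν' (μ'.prod ν')))

lemma integral_exchange {F : (X × Y) × (X × Y) → ℝ} (hF : Measurable F) :
    ∫ p, F (exchange p) ∂((μ'.prod ν').prod (μ'.prod ν')) =
      ∫ p, F p ∂((μ'.prod ν').prod (μ'.prod ν')) := by
  have hmp := measurePreserving_exchange (μ' := μ') (ν' := ν')
  rw [← integral_map hmp.measurable.aemeasurable hF.aestronglyMeasurable, hmp.map_eq]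

variable {h : X × Y → ℝ}

lemma measurable_exchange : Measurable (exchange (X := X) (Y := Y)) := by
  unfold exchange
  fun_prop

lemma measurable_mixedDiff (hm : Measurable h) : Measurable (mixedDiff h) := by
  have := measurable_exchange (X := X) (Y := Y)
  unfold mixedDiff
  fun_prop

lemma measurable_cornerMin (hm : Measurable h) : Measurable (cornerMin h) := by
  have := measurable_exchange (X := X) (Y := Y)
  unfold cornerMin
  fun_prop

lemma measurable_weight (hm : Measurable h) : Measurable (weight h) := by
  have h1 := measurable_mixedDiff hm
  have h2 := measurable_cornerMin hm
  unfold weight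
  fun_prop

lemma integral_mul_eq_zero_of_exchange {u w : (X × Y) × (X × Y) → ℝ} (hu : Measurable u)
    (hw : Measurable w) (hue : ∀ p, u (exchange p) = u p) (hwe : ∀ p, w (exchange p) = -w p) :
    ∫ p, u p * w p ∂((μ'.prod ν').prod (μ'.prod ν')) = 0 := by
  have := integral_exchange (μ' := μ') (ν' := ν') (hu.mul hw)
  simp only [Pi.mul_apply, hue, hwe, mul_neg, integral_neg] at this
  linarith

lemma integrable_weight (hm : Measurable h) (hpos : ∀ z, 0 ≤ h z) :
    Integrable (weight h) ((μ'.prod ν').prod (μ'.prod ν')) :=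
  Integrable.of_bound (measurable_weight hm).aestronglyMeasurable 1
    (ae_of_all _ fun p => abs_weight_le_one hpos p)

/-- A minimal density that is positive almost everywhere is additively separated. -/
lemma IsMinimalDensity.mixedDiff_eq_zero {μ : Measure X} {ν : Measure Y}
    (hh : IsMinimalDensity (μ'.prod ν') μ ν h) (hm : Measurable h) (hnn : ∀ z, 0 ≤ h z)
    (hpos : ∀ᵐ z ∂(μ'.prod ν'), 0 < h z) :
    ∀ᵐ p ∂((μ'.prod ν').prod (μ'.prod ν')), mixedDiff h p = 0 := by
  set P := μ'.prod ν' with hP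
  have hwm := measurable_weight hm
  have hem := measurable_exchange (X := X) (Y := Y)
  have hwi : Integrable (weight h) (P.prod P) := integrable_weight hm hnn
  let φ : X × Y → ℝ := fun z => ∫ z', weight h (z, z') ∂P
  have hφm : StronglyMeasurable φ := hwm.stronglyMeasurable.integral_prod_right'
  have hφ1 : ∀ z, |φ z| ≤ 1 := fun z => by
    have := norm_integral_le_of_norm_le_const (μ := P) (f := fun z' => weight h (z, z'))
      (ae_of_all _ fun z' => abs_weight_le_one hnn (z, z'))
    simpa using this
  have hφh : ∀ z, |φ z| ≤ h z := fun z => by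
    have := norm_integral_le_of_norm_le_const (μ := P) (f := fun z' => weight h (z, z')) (C := h z)
      (ae_of_all _ fun z' => abs_weight_le_left hnn (z, z'))
    simpa using this
  have hφL : MemLp φ 2 P := MemLp.of_bound hφm.aestronglyMeasurable 1 (ae_of_all _ hφ1)
  -- Integrals of `φ` over a set, written as integrals over pairs of points.
  have hset : ∀ s : Set (X × Y), MeasurableSet s → ∫ z in s, φ z ∂P =
      ∫ p, s.indicator (fun _ => (1 : ℝ)) p.1 * weight h p ∂(P.prod P) := by
    intro s hs
    rw [integral_prod, ← integral_indicator hs]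
    · refine integral_congr_ae (ae_of_all _ fun z => ?_)
      simp only [integral_const_mul]
      by_cases hz : z ∈ s <;> simp [hz, φ]
    · refine hwi.mono (by fun_prop (disch := measurability)) (ae_of_all _ fun p => ?_)
      by_cases hz : p.1 ∈ s <;> simp [hz]
  have hφ₁ : ∀ A, MeasurableSet A → ∫ z in Prod.fst ⁻¹' A, φ z ∂P = 0 := by
    intro A hA
    rw [hset _ (measurable_fst hA)]
    refine integral_mul_eq_zero_of_exchange ?_ hwm (fun p => rfl) weight_exchange
    exact (measurable_const.indicator (measurable_fst hA)).comp measurable_fst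
  have hφ₂ : ∀ B, MeasurableSet B → ∫ z in Prod.snd ⁻¹' B, φ z ∂P = 0 := by
    intro B hB
    rw [hset _ (measurable_snd hB)]
    have hum : Measurable fun p : (X × Y) × (X × Y) =>
        (Prod.snd ⁻¹' B).indicator (fun _ => (1 : ℝ)) p.1 :=
      (measurable_const.indicator (measurable_snd hB)).comp measurable_fst
    -- An exchange followed by a swap fixes the `Y`-coordinate of the first point.
    have h1 := integral_exchange (μ' := μ') (ν' := ν') (hum.mul hwm)
    rw [← integral_prod_swap] at h1
    have h2 : ∀ p : (X × Y) × (X × Y),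
        (Prod.snd ⁻¹' B).indicator (fun _ => (1 : ℝ)) (exchange p.swap).1 =
          (Prod.snd ⁻¹' B).indicator (fun _ => (1 : ℝ)) p.1 := fun p => rfl
    simp only [Pi.mul_apply, weight_exchange, weight_swap, h2, mul_neg, integral_neg] at h1
    linarith
  have horth := hh.integral_mul_eq_zero hφL (ae_of_all _ hφh) hφ₁ hφ₂
  -- Orthogonality of `h` and `φ` at one corner carries over to the other three by the symmetries
  -- of the weight, so each corner contributes zero to `∫ mixedDiff * weight`.
  have hi1 : Integrable (fun p : (X × Y) × (X × Y) => h p.1 * weight h p) (P.prod P) := by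
    refine (hh.1.integrable.comp_fst P).mul_bdd (c := 1) hwm.aestronglyMeasurable
      (ae_of_all _ fun p => abs_weight_le_one hnn p)
  have hI1 : ∫ p, h p.1 * weight h p ∂(P.prod P) = 0 := by
    rw [integral_prod _ hi1, ← horth]
    refine integral_congr_ae (ae_of_all _ fun z => ?_)
    simp only [integral_const_mul, φ]
  have hi2 : Integrable (fun p : (X × Y) × (X × Y) => h p.2 * weight h p) (P.prod P) := by
    have := hi1.swap
    simpa only [Function.comp_def, weight_swap, Prod.fst_swap] using this
  have hI2 : ∫ p, h p.2 * weight h p ∂(P.prod P) = 0 := by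
    rw [← hI1, ← integral_prod_swap]
    simp only [weight_swap, Prod.snd_swap]
  have hmp := measurePreserving_exchange (μ' := μ') (ν' := ν')
  have hi3 : Integrable (fun p => h (exchange p).1 * weight h p) (P.prod P) := by
    have := (hmp.integrable_comp_of_integrable hi1).neg
    refine this.congr (ae_of_all _ fun p => ?_)
    simp [weight_exchange]
  have hI3 : ∫ p, h (exchange p).1 * weight h p ∂(P.prod P) = 0 := by
    have := integral_exchange (μ' := μ') (ν' := ν')
      (F := fun p => h p.1 * weight h p) (by fun_prop)
    simp only [weight_exchange, mul_neg, integral_neg] at this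
    rw [← hP, hI1] at this
    linarith
  have hi4 : Integrable (fun p => h (exchange p).2 * weight h p) (P.prod P) := by
    have := (hmp.integrable_comp_of_integrable hi2).neg
    refine this.congr (ae_of_all _ fun p => ?_)
    simp [weight_exchange]
  have hI4 : ∫ p, h (exchange p).2 * weight h p ∂(P.prod P) = 0 := by
    have := integral_exchange (μ' := μ') (ν' := ν')
      (F := fun p => h p.2 * weight h p) (by fun_prop)
    simp only [weight_exchange, mul_neg, integral_neg] at this
    rw [← hP, hI2] at this
    linarith
  have hsplit : (fun p => mixedDiff h p * weight h p) = fun p => h p.1 * weight h p +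
      h p.2 * weight h p - h (exchange p).1 * weight h p - h (exchange p).2 * weight h p := by
    ext p
    simp only [mixedDiff]
    ring
  have hi12 : Integrable (fun p => h p.1 * weight h p + h p.2 * weight h p) (P.prod P) :=
    hi1.add hi2
  have hi123 : Integrable (fun p => h p.1 * weight h p + h p.2 * weight h p -
      h (exchange p).1 * weight h p) (P.prod P) := hi12.sub hi3
  have hint : Integrable (fun p => mixedDiff h p * weight h p) (P.prod P) := by
    rw [hsplit]
    exact hi123.sub hi4
  have hzero : ∫ p, mixedDiff h p * weight h p ∂(P.prod P) = 0 := by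
    rw [hsplit, integral_sub hi123 hi4, integral_sub hi12 hi3, integral_add hi1 hi2, hI1, hI2, hI3,
      hI4]
    simp
  have hsq : ∀ p, mixedDiff h p * weight h p =
      mixedDiff h p ^ 2 / (1 + |mixedDiff h p|) * cornerMin h p := fun p => by
    rw [weight]
    ring
  have hge : 0 ≤ fun p => mixedDiff h p * weight h p := fun p => by
    have := cornerMin_nonneg hnn p
    simp only [Pi.zero_apply, hsq]
    positivity
  rw [integral_eq_zero_iff_of_nonneg hge hint] at hzero
  have hp1 : ∀ᵐ p ∂(P.prod P), 0 < h p.1 := Measure.quasiMeasurePreserving_fst.ae hpos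
  have hp2 : ∀ᵐ p ∂(P.prod P), 0 < h p.2 := Measure.quasiMeasurePreserving_snd.ae hpos
  filter_upwards [hzero, hp1, hp2, hmp.quasiMeasurePreserving.ae hp1,
    hmp.quasiMeasurePreserving.ae hp2] with p hp h1 h2 h3 h4
  have hc : 0 < cornerMin h p := by simp [cornerMin, h1, h2, h3, h4]
  rw [hsq] at hp
  have hd : (1 + |mixedDiff h p|) ≠ 0 := by positivity
  simpa [hc.ne', hd] using hp

end

variable {X Y : Type*} [MeasurableSpace X] [MeasurableSpace Y]

/-! ### Additively separated densities and duality -/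

section

variable {P : Measure (X × Y)} [IsProbabilityMeasure P] {μ : Measure X} {ν : Measure Y}
  [IsFiniteMeasure μ] [IsFiniteMeasure ν] {h : X × Y → ℝ}

/-- Separated functions see only the marginals of a coupling. -/
lemma IsCouplingDensity.integral_mul_add (hh : IsCouplingDensity P μ ν h) {f : X → ℝ} {g : Y → ℝ}
    (hf : Integrable f μ) (hg : Integrable g ν) :
    Integrable (fun z => h z * (f z.1 + g z.2)) P ∧
      ∫ z, h z * (f z.1 + g z.2) ∂P = ∫ x, f x ∂μ + ∫ y, g y ∂ν := by
  set π := P.withDensity fun z => ENNReal.ofReal (h z)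
  obtain ⟨h1, h2⟩ := hh.withDensity_mem_couplings
  have hm : AEMeasurable (fun z => ENNReal.ofReal (h z)) P := hh.memLp.1.aemeasurable.ennreal_ofReal
  have hlt : ∀ᵐ z ∂P, ENNReal.ofReal (h z) < ∞ := ae_of_all _ fun z => ENNReal.ofReal_lt_top
  have hf' : Integrable f (π.map Prod.fst) := by rwa [h1]
  have hg' : Integrable g (π.map Prod.snd) := by rwa [h2]
  have hfπ : Integrable (fun z => f z.1) π := hf'.comp_measurable measurable_fst
  have hgπ : Integrable (fun z => g z.2) π := hg'.comp_measurable measurable_snd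
  have hint : Integrable (fun z => f z.1 + g z.2) π := hfπ.add hgπ
  have hcongr : (fun z => (ENNReal.ofReal (h z)).toReal • (f z.1 + g z.2)) =ᵐ[P]
      fun z => h z * (f z.1 + g z.2) := by
    filter_upwards [hh.nonneg] with z hz
    rw [ENNReal.toReal_ofReal hz, smul_eq_mul]
  refine ⟨((integrable_withDensity_iff_integrable_smul₀' hm hlt).1 hint).congr hcongr, ?_⟩
  rw [← integral_congr_ae hcongr, ← integral_withDensity_eq_integral_toReal_smul₀ hm hlt,
    integral_add hfπ hgπ, ← integral_map measurable_fst.aemeasurable hf'.1,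
    ← integral_map measurable_snd.aemeasurable hg'.1, h1, h2]

/-- A coupling density which is additively separated has the least norm: its inner product with
a coupling density does not depend on the latter. -/
lemma IsCouplingDensity.isMinimalDensity_of_add (hh : IsCouplingDensity P μ ν h) {f : X → ℝ}
    {g : Y → ℝ} (hf : Integrable f μ) (hg : Integrable g ν)
    (hfg : h =ᵐ[P] fun z => f z.1 + g z.2) : IsMinimalDensity P μ ν h := by
  refine ⟨hh, fun k hk => ?_⟩
  have hinner : ∀ l, IsCouplingDensity P μ ν l →
      ∫ z, l z * h z ∂P = ∫ x, f x ∂μ + ∫ y, g y ∂ν := fun l hl => by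
    rw [← (hl.integral_mul_add hf hg).2]
    refine integral_congr_ae ?_
    filter_upwards [hfg] with z hz
    rw [hz]
  have hhh := hinner h hh
  have hkh := hinner k hk
  have hmul : Integrable (fun z => k z * h z) P := hk.memLp.integrable_mul hh.memLp
  have h2 : ∫ z, h z ^ 2 ∂P = ∫ z, h z * h z ∂P := by simp only [pow_two]
  have hle : ∫ z, (2 * (k z * h z) - h z ^ 2) ∂P ≤ ∫ z, k z ^ 2 ∂P := by
    refine integral_mono ((hmul.const_mul 2).sub hh.memLp.integrable_sq) hk.memLp.integrable_sq
      fun z => ?_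
    nlinarith [sq_nonneg (k z - h z)]
  rw [integral_sub (hmul.const_mul 2) hh.memLp.integrable_sq, integral_const_mul] at hle
  linarith

/-- Weak duality. -/
lemma IsCouplingDensity.dualObjective_le (hh : IsCouplingDensity P μ ν h) {f : X → ℝ} {g : Y → ℝ}
    (hf : Integrable f μ) (hg : Integrable g ν)
    (hfP : AEStronglyMeasurable (fun z => f z.1) P)
    (hgP : AEStronglyMeasurable (fun z => g z.2) P) :
    dualObjective (fun _ => 0) P μ ν f g ≤ ((1 / 2 * ∫ z, h z ^ 2 ∂P : ℝ) : EReal) := by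
  obtain ⟨hint, heq⟩ := hh.integral_mul_add hf hg
  rw [dualObjective]
  by_cases hL : ∫⁻ z, ENNReal.ofReal ((max (f z.1 + g z.2 - 0) 0) ^ 2) ∂P = ∞
  · rw [hL, ENNReal.mul_top (by simp), EReal.coe_ennreal_top, EReal.sub_top]
    exact bot_le
  have hi : Integrable (fun z => (max (f z.1 + g z.2 - 0) 0) ^ 2) P := by
    refine ⟨?_, ?_⟩
    · have hc : Continuous fun r : ℝ => (max (r - 0) 0) ^ 2 := by fun_prop
      exact hc.comp_aestronglyMeasurable (hfP.add hgP)
    · rw [hasFiniteIntegral_iff_ofReal (ae_of_all _ fun z => sq_nonneg _)]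
      exact lt_top_iff_ne_top.2 hL
  rw [← ofReal_integral_eq_lintegral_ofReal hi (ae_of_all _ fun z => sq_nonneg _),
    coe_half_mul_ofReal (integral_nonneg fun z => sq_nonneg _), ← EReal.coe_sub,
    EReal.coe_le_coe_iff, ← heq, sub_le_iff_le_add, ← mul_add,
    ← integral_add hh.memLp.integrable_sq hi, ← integral_const_mul]
  refine integral_mono_ae hint ((hh.memLp.integrable_sq.add hi).const_mul _) ?_
  filter_upwards [hh.nonneg] with z hz
  simp only [sub_zero, Pi.zero_apply] at *
  nlinarith [sq_nonneg (h z - max (f z.1 + g z.2) 0),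
    mul_le_mul_of_nonneg_left (le_max_left (f z.1 + g z.2) 0) hz]

/-- Complementary slackness: if `(f ⊕ g)₊` is a coupling density, there is no duality gap. -/
lemma IsCouplingDensity.dualObjective_eq {f : X → ℝ} {g : Y → ℝ}
    (hh : IsCouplingDensity P μ ν fun z => max (f z.1 + g z.2 - 0) 0)
    (hf : Integrable f μ) (hg : Integrable g ν) :
    dualObjective (fun _ => 0) P μ ν f g =
      ((1 / 2 * ∫ z, (max (f z.1 + g z.2 - 0) 0) ^ 2 ∂P : ℝ) : EReal) := by
  have heq := (hh.integral_mul_add hf hg).2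
  have hsq : ∫ z, max (f z.1 + g z.2 - 0) 0 * (f z.1 + g z.2) ∂P =
      ∫ z, (max (f z.1 + g z.2 - 0) 0) ^ 2 ∂P := by
    refine integral_congr_ae (ae_of_all _ fun z => ?_)
    simp only [sub_zero]
    rcases le_total (f z.1 + g z.2) 0 with h0 | h0
    · simp [max_eq_right h0]
    · rw [max_eq_left h0, pow_two]
  rw [dualObjective, ← ofReal_integral_eq_lintegral_ofReal hh.memLp.integrable_sq
    (ae_of_all _ fun z => sq_nonneg _),
    coe_half_mul_ofReal (integral_nonneg fun z => sq_nonneg _), ← EReal.coe_sub,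
    ← heq, hsq]
  congr 1
  ring

end

/-! ### The density `dμ/dμ' + dν/dν' - 1` -/

lemma integral_density {Ω : Type*} [MeasurableSpace Ω] {ρ σ : Measure Ω} [IsProbabilityMeasure ρ]
    [SigmaFinite σ] (hac : ρ ≪ σ) : ∫ x, density ρ σ x ∂σ = 1 := by
  simp only [density]
  rw [Measure.integral_toReal_rnDeriv hac]
  simp

lemma integrable_density {Ω : Type*} [MeasurableSpace Ω] (ρ σ : Measure Ω) [IsFiniteMeasure ρ] :
    Integrable (density ρ σ) σ :=
  Measure.integrable_toReal_rnDeriv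

section

variable {μ μ' : Measure X} {ν ν' : Measure Y} [IsProbabilityMeasure μ'] [IsProbabilityMeasure ν']

/-- The marginal condition of a coupling density in disintegrated form. -/
lemma IsCouplingDensity.integral_right_ae_eq {h : X × Y → ℝ}
    [IsFiniteMeasure μ]
    (hh : IsCouplingDensity (μ'.prod ν') μ ν h) (hac : μ ≪ μ') :
    ∀ᵐ x ∂μ', ∫ y, h (x, y) ∂ν' = density μ μ' x := by
  refine Integrable.ae_eq_of_forall_setIntegral_eq _ _ hh.integrable.integral_prod_left
    (integrable_density μ μ') fun A hA _ => ?_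
  refine Eq.trans ?_ (Measure.setIntegral_toReal_rnDeriv hac A).symm
  rw [← hh.fst A hA, ← Set.prod_univ, setIntegral_prod _ hh.integrable.integrableOn]
  simp

lemma IsCouplingDensity.integral_left_ae_eq {h : X × Y → ℝ}
    [IsFiniteMeasure ν]
    (hh : IsCouplingDensity (μ'.prod ν') μ ν h) (hac : ν ≪ ν') :
    ∀ᵐ y ∂ν', ∫ x, h (x, y) ∂μ' = density ν ν' y := by
  refine Integrable.ae_eq_of_forall_setIntegral_eq _ _ hh.integrable.integral_prod_right
    (integrable_density ν ν') fun B hB _ => ?_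
  refine Eq.trans ?_ (Measure.setIntegral_toReal_rnDeriv hac B).symm
  have hi : Integrable (fun z : Y × X => h z.swap) ((ν'.restrict B).prod μ') := by
    have := hh.integrable.swap
    rw [← Measure.restrict_univ (μ := μ'), Measure.prod_restrict]
    exact this.integrableOn
  rw [← hh.snd B hB, ← Set.univ_prod, ← Measure.prod_restrict, Measure.restrict_univ,
    ← integral_prod_swap, integral_prod _ hi]
  rfl

end

section

variable {μ μ' : Measure X} {ν ν' : Measure Y} [IsProbabilityMeasure μ] [IsProbabilityMeasure μ']
  [IsProbabilityMeasure ν] [IsProbabilityMeasure ν']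

lemma AdmissibleReference.integrable_density_left {Ω : Type*} [MeasurableSpace Ω] {ρ σ : Measure Ω}
    [IsFiniteMeasure ρ] [SigmaFinite σ] (hρ : AdmissibleReference ρ σ) :
    Integrable (density ρ σ) ρ := by
  rw [← integrable_rnDeriv_smul_iff hρ.equivalent.1]
  exact hρ.memLp_density.integrable_sq.congr (ae_of_all _ fun x => pow_two _)

/-- The product coupling has finite cost. -/
lemma isCouplingDensity_mul (hμ : AdmissibleReference μ μ') (hν : AdmissibleReference ν ν') :
    IsCouplingDensity (μ'.prod ν') μ ν fun z => density μ μ' z.1 * density ν ν' z.2 where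
  memLp := by
    have h1 := measurable_density μ μ'
    have h2 := measurable_density ν ν'
    rw [memLp_two_iff_integrable_sq (by fun_prop)]
    simp only [mul_pow]
    exact hμ.memLp_density.integrable_sq.mul_prod hν.memLp_density.integrable_sq
  nonneg := ae_of_all _ fun z => mul_nonneg (density_nonneg _ _ _) (density_nonneg _ _ _)
  fst A _ := by
    rw [← Set.prod_univ, setIntegral_prod_mul, setIntegral_univ, integral_density hν.equivalent.1,
      mul_one]
    exact Measure.setIntegral_toReal_rnDeriv hμ.equivalent.1 A
  snd B _ := by
    rw [← Set.univ_prod, setIntegral_prod_mul, setIntegral_univ, integral_density hμ.equivalent.1,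
      one_mul]
    exact Measure.setIntegral_toReal_rnDeriv hν.equivalent.1 B

/-- The signed function `dμ/dμ' + dν/dν' - 1` always has the right marginals, so it is a coupling
density as soon as it is nonnegative. -/
lemma isCouplingDensity_add_sub_one (hμ : AdmissibleReference μ μ')
    (hν : AdmissibleReference ν ν')
    (hpos : ∀ᵐ z ∂(μ'.prod ν'), 1 ≤ density μ μ' z.1 + density ν ν' z.2) :
    IsCouplingDensity (μ'.prod ν') μ ν fun z => density μ μ' z.1 + density ν ν' z.2 - 1 where
  memLp := ((hμ.memLp_density.comp_fst ν').add (hν.memLp_density.comp_snd μ')).sub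
    (memLp_const 1)
  nonneg := by
    filter_upwards [hpos] with z hz
    simpa using hz
  fst A _ := by
    have h1 : Integrable (fun z : X × Y => density μ μ' z.1) ((μ'.restrict A).prod ν') :=
      (integrable_density μ μ').integrableOn.comp_fst ν'
    have h2 : Integrable (fun z : X × Y => density ν ν' z.2) ((μ'.restrict A).prod ν') :=
      (integrable_density ν ν').comp_snd _
    have h12 : Integrable (fun z : X × Y => density μ μ' z.1 + density ν ν' z.2)
        ((μ'.restrict A).prod ν') := h1.add h2
    rw [← Set.prod_univ, ← Measure.prod_restrict, Measure.restrict_univ,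
      integral_sub h12 (integrable_const 1), integral_add h1 h2, integral_fun_fst,
      integral_fun_snd, integral_density hν.equivalent.1, integral_const]
    have := Measure.setIntegral_toReal_rnDeriv hμ.equivalent.1 A
    simp only [density, this]
    simp [measureReal_def, Measure.prod_apply]
  snd B _ := by
    have h1 : Integrable (fun z : X × Y => density μ μ' z.1) (μ'.prod (ν'.restrict B)) :=
      (integrable_density μ μ').comp_fst _
    have h2 : Integrable (fun z : X × Y => density ν ν' z.2) (μ'.prod (ν'.restrict B)) :=
      (integrable_density ν ν').integrableOn.comp_snd μ'
    have h12 : Integrable (fun z : X × Y => density μ μ' z.1 + density ν ν' z.2)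
        (μ'.prod (ν'.restrict B)) := h1.add h2
    rw [← Set.univ_prod, ← Measure.prod_restrict, Measure.restrict_univ,
      integral_sub h12 (integrable_const 1), integral_add h1 h2, integral_fun_fst,
      integral_fun_snd, integral_density hμ.equivalent.1, integral_const]
    have := Measure.setIntegral_toReal_rnDeriv hν.equivalent.1 B
    simp only [density, this]
    simp [measureReal_def, Measure.prod_apply]

lemma isMinimalDensity_add_sub_one (hμ : AdmissibleReference μ μ')
    (hν : AdmissibleReference ν ν')
    (hpos : ∀ᵐ z ∂(μ'.prod ν'), 1 ≤ density μ μ' z.1 + density ν ν' z.2) :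
    IsMinimalDensity (μ'.prod ν') μ ν fun z => density μ μ' z.1 + density ν ν' z.2 - 1 :=
  (isCouplingDensity_add_sub_one hμ hν hpos).isMinimalDensity_of_add
    (g := fun y => density ν ν' y - 1) hμ.integrable_density_left
    (hν.integrable_density_left.sub (integrable_const 1)) (ae_of_all _ fun _ => add_sub_assoc _ _ _)

/-- A minimal density that is positive almost everywhere is separated; averaging the four-point
identity over the second point identifies the summands. -/
lemma IsMinimalDensity.ae_eq_add_sub_one {h : X × Y → ℝ}
    (hh : IsMinimalDensity (μ'.prod ν') μ ν h) (hm : Measurable h) (hnn : ∀ z, 0 ≤ h z)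
    (hpos : ∀ᵐ z ∂(μ'.prod ν'), 0 < h z) (hμ : μ ≪ μ') (hν : ν ≪ ν') :
    ∀ᵐ z ∂(μ'.prod ν'), h z = density μ μ' z.1 + density ν ν' z.2 - 1 := by
  set P := μ'.prod ν' with hP
  have h1 : ∫ z, h z ∂P = 1 := by
    have := hh.1.fst Set.univ MeasurableSet.univ
    simpa using this
  have hi := hh.1.integrable
  have hsec := hi.prod_right_ae
  have hsec' := hi.prod_left_ae
  filter_upwards [Measure.ae_ae_of_ae_prod (hh.mixedDiff_eq_zero hm hnn hpos),
    Measure.quasiMeasurePreserving_fst.ae (hh.1.integral_right_ae_eq hμ),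
    Measure.quasiMeasurePreserving_snd.ae (hh.1.integral_left_ae_eq hν),
    Measure.quasiMeasurePreserving_fst.ae hsec, Measure.quasiMeasurePreserving_snd.ae hsec']
    with z hz ha hb hia hib
  have hia' : Integrable (fun p : X × Y => h (z.1, p.2)) P := hia.comp_snd μ'
  have hib' : Integrable (fun p : X × Y => h (p.1, z.2)) P := hib.comp_fst ν'
  have hIa : ∫ p, h (z.1, p.2) ∂P = density μ μ' z.1 := by
    rw [hP, integral_fun_snd (fun y => h (z.1, y)), ha]
    simp
  have hIb : ∫ p, h (p.1, z.2) ∂P = density ν ν' z.2 := by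
    rw [hP, integral_fun_fst (fun x => h (x, z.2)), hb]
    simp
  have hsum : ∫ p, h p ∂P = ∫ p, (h (z.1, p.2) + h (p.1, z.2) - h z) ∂P := by
    refine integral_congr_ae ?_
    filter_upwards [hz] with p hp
    simp only [mixedDiff, exchange] at hp
    linarith
  have hab : Integrable (fun p : X × Y => h (z.1, p.2) + h (p.1, z.2)) P := hia'.add hib'
  rw [integral_sub hab (integrable_const _), integral_add hia' hib', hIa, hIb, h1,
    integral_const] at hsum
  simp only [probReal_univ, smul_eq_mul, one_mul] at hsum
  linarith

lemma isPotentials_density_sub_half (hμ : AdmissibleReference μ μ')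
    (hν : AdmissibleReference ν ν')
    (hpos : ∀ᵐ z ∂(μ'.prod ν'), 1 < density μ μ' z.1 + density ν ν' z.2) :
    IsPotentials (fun _ => 0) μ μ' ν ν' (fun x => density μ μ' x - 1 / 2)
      (fun y => density ν ν' y - 1 / 2) := by
  have hmin := isMinimalDensity_add_sub_one hμ hν (hpos.mono fun z hz => hz.le)
  have heq : (fun z : X × Y => density μ μ' z.1 + density ν ν' z.2 - 1) =ᵐ[μ'.prod ν'] fun z =>
      max ((density μ μ' z.1 - 1 / 2) + (density ν ν' z.2 - 1 / 2) - 0) 0 := by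
    filter_upwards [hpos] with z hz
    rw [max_eq_left (by linarith)]
    ring
  have hcd := hmin.1.congr heq
  have hf : Integrable (fun x => density μ μ' x - 1 / 2) μ :=
    hμ.integrable_density_left.sub (integrable_const _)
  have hg : Integrable (fun y => density ν ν' y - 1 / 2) ν :=
    hν.integrable_density_left.sub (integrable_const _)
  refine ⟨(measurable_density _ _).sub_const _, (measurable_density _ _).sub_const _, ?_,
    ⟨hf, hg, fun f' g' hf' hg' => ?_⟩, hcd.integral_left_ae_eq hν.equivalent.1,
    hcd.integral_right_ae_eq hμ.equivalent.1⟩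
  · rw [← withDensity_congr_ae (heq.mono fun z hz => congrArg ENNReal.ofReal hz)]
    exact hmin.isOptimalCoupling
  · rw [hcd.dualObjective_eq hf hg]
    exact hcd.dualObjective_le hf' hg' (hf'.1.mono_ac hμ.equivalent.2).comp_fst
      (hg'.1.mono_ac hν.equivalent.2).comp_snd

end

end QOT

/-! ### The optimal coupling -/

theorem propositionA2 {X Y : Type*} [MeasurableSpace X] [MeasurableSpace Y]
    [MeasurableSpace.CountablyGenerated X] [MeasurableSpace.CountablyGenerated Y]
    (μ μ' : Measure X) (ν ν' : Measure Y)
    [IsProbabilityMeasure μ] [IsProbabilityMeasure μ']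
    [IsProbabilityMeasure ν] [IsProbabilityMeasure ν']
    (hμ : QOT.AdmissibleReference μ μ') (hν : QOT.AdmissibleReference ν ν') :
    (∃! π : Measure (X × Y), QOT.IsOptimalCoupling (fun _ => 0) (μ'.prod ν') μ ν π) ∧
    ∀ π : Measure (X × Y), QOT.IsOptimalCoupling (fun _ => 0) (μ'.prod ν') μ ν π →
      (QOT.Equivalent π (μ'.prod ν') ↔
        ∀ᵐ z ∂(μ'.prod ν'), 1 < QOT.density μ μ' z.1 + QOT.density ν ν' z.2) ∧
      (QOT.Equivalent π (μ'.prod ν') →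
        (∀ᵐ z ∂(μ'.prod ν'), QOT.density π (μ'.prod ν') z =
          QOT.density μ μ' z.1 + QOT.density ν ν' z.2 - 1) ∧
        QOT.IsPotentials (fun _ => 0) μ μ' ν ν'
          (fun x => QOT.density μ μ' x - 1 / 2) (fun y => QOT.density ν ν' y - 1 / 2)) ∧
      (ν = ν' → π = μ.prod ν) := by
  set P := μ'.prod ν' with hP
  have hprod := QOT.isCouplingDensity_mul hμ hν
  obtain ⟨h, hh⟩ := QOT.exists_isMinimalDensity hprod
  refine ⟨⟨_, hh.isOptimalCoupling, fun π hπ => ?_⟩, fun π hπ => ?_⟩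
  · obtain ⟨hac, hd⟩ := hπ.isMinimalDensity hprod
    have := QOT.isProbabilityMeasure_of_mem_couplings hπ.1
    rw [← QOT.withDensity_ofReal_density hac]
    exact withDensity_congr_ae ((hd.ae_eq hh).mono fun z hz => congrArg ENNReal.ofReal hz)
  obtain ⟨hac, hd⟩ := hπ.isMinimalDensity hprod
  have := QOT.isProbabilityMeasure_of_mem_couplings hπ.1
  -- If `dμ/dμ' + dν/dν' ≥ 1`, then uniqueness identifies the density of `π`.
  have hdens : (∀ᵐ z ∂P, 1 ≤ QOT.density μ μ' z.1 + QOT.density ν ν' z.2) →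
      ∀ᵐ z ∂P, QOT.density π P z = QOT.density μ μ' z.1 + QOT.density ν ν' z.2 - 1 := fun hpos =>
    hd.ae_eq (QOT.isMinimalDensity_add_sub_one hμ hν hpos)
  have hforward : QOT.Equivalent π P →
      (∀ᵐ z ∂P, QOT.density π P z = QOT.density μ μ' z.1 + QOT.density ν ν' z.2 - 1) ∧
        ∀ᵐ z ∂P, 1 < QOT.density μ μ' z.1 + QOT.density ν ν' z.2 := by
    intro he
    have hpos : ∀ᵐ z ∂P, 0 < QOT.density π P z := by
      filter_upwards [Measure.rnDeriv_pos' he.2, Measure.rnDeriv_lt_top π P] with z h0 h1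
      exact ENNReal.toReal_pos h0.ne' h1.ne
    have heq := hd.ae_eq_add_sub_one (QOT.measurable_density π P) (QOT.density_nonneg π P) hpos
      hμ.equivalent.1 hν.equivalent.1
    refine ⟨heq, ?_⟩
    filter_upwards [heq, hpos] with z h0 h1
    linarith
  refine ⟨⟨fun he => (hforward he).2, fun hpos => ⟨hac, ?_⟩⟩, fun he => ⟨(hforward he).1,
    QOT.isPotentials_density_sub_half hμ hν (hforward he).2⟩, fun hνν' => ?_⟩
  · rw [← QOT.withDensity_ofReal_density hac]
    refine withDensity_absolutelyContinuous' ?_ ?_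
    · exact (QOT.measurable_density π P).ennreal_ofReal.aemeasurable
    · filter_upwards [hdens (hpos.mono fun z hz => hz.le), hpos] with z h0 h1
      rw [h0]
      exact (ENNReal.ofReal_pos.2 (by linarith)).ne'
  · -- Here `dν/dν' = 1`, so the density of `π` is that of `μ ⊗ ν`.
    subst hνν'
    have hself : ∀ᵐ y ∂ν, QOT.density ν ν y = 1 := by
      filter_upwards [Measure.rnDeriv_self ν] with y hy
      simp [QOT.density, hy]
    have hone : ∀ᵐ z ∂P, QOT.density ν ν z.2 = 1 := Measure.quasiMeasurePreserving_snd.ae hself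
    have hge : ∀ᵐ z ∂P, 1 ≤ QOT.density μ μ' z.1 + QOT.density ν ν z.2 := by
      filter_upwards [hone] with z hz
      linarith [QOT.density_nonneg μ μ' z.1]
    rw [← QOT.withDensity_ofReal_density hac]
    conv_rhs => rw [← QOT.withDensity_ofReal_density hμ.equivalent.1]
    rw [prod_withDensity_left
      (QOT.measurable_density μ μ').ennreal_ofReal]
    refine withDensity_congr_ae ?_
    filter_upwards [hdens hge, hone] with z h0 h1
    rw [h0, h1, add_sub_cancel_right]
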